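/- Let $f\colon\mathbb{R}^2\to\mathbb{R}$. Say that $f$ is feebly continuous at $(x,y)\in\mathbb{R}^2$ if there exist strictly decreasing sequences $x_n\to x$ and $y_m\to y$ such that $\lim_{n\to\infty}\lim_{m\to\infty}f(x_n,y_m)=f(x,y)$ (all the limits being required to exist in $\mathbb{R}$), and let $FC(f)$ be the set of all points at which $f$ is feebly continuous. A perfect set is a nonempty closed set without isolated points. The function $f$ has the Baire property if $f^{-1}(U)$ has the Baire property for every open $U\subset\mathbb{R}$. 1. If $f$ has the Baire property, then for every nonmeager set $B\subset\mathbb{R}^2$ having the Baire property, the intersection $FC(f)\cap B$ contains a product $P\times Q$ of two perfect sets $P,Q\subset\mathbb{R}$. Moreover, $FC(f)$ is residual in $\mathbb{R}^2$, that is, its complement is meager. 2. If $f$ is Lebesgue measurable, then for every Lebesgue measurable set $B\subset\mathbb{R}^2$ of positive measure, the intersection $FC(f)\cap B$ contains a product $P\times Q$ of two perfect sets $P,Q\subset\mathbb{R}$. Moreover, $FC(f)$ has full outer Lebesgue measure, that is, $\lambda^*(FC(f)\cap E)=\lambda(E)$ for every Lebesgue measurable set $E\subset\mathbb{R}^2$,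 where $\lambda$ is the Lebesgue measure on $\mathbb{R}^2$ and $\lambda^*$ its outer measure. -/

import Mathlib

open Filter Topology MeasureTheory

/-- `f` is feebly continuous at `z = (x, y)`: there are strictly decreasing sequences `u n → x` and
`v m → y` such that `lim_n lim_m f (u n, v m) = f (x, y)`, where all the inner limits `L n` exist
(as real numbers), and so does the outer one. -/
def FeeblyContinuousAt (f : ℝ × ℝ → ℝ) (z : ℝ × ℝ) : Prop :=
  ∃ u v : ℕ → ℝ,
    StrictAnti u ∧ Tendsto u atTop (𝓝 z.1) ∧
    StrictAnti v ∧ Tendsto v atTop (𝓝 z.2) ∧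
    ∃ L : ℕ → ℝ,
      (∀ n, Tendsto (fun m => f (u n, v m)) atTop (𝓝 (L n))) ∧
      Tendsto L atTop (𝓝 (f z))

/-- The set of points of feeble continuity of `f`. -/
def FC (f : ℝ × ℝ → ℝ) : Set (ℝ × ℝ) := {z | FeeblyContinuousAt f z}

/-- A function on the plane has the Baire property if the preimage of every open set has the Baire
property, that is, differs from some open set by a meager set. -/
def HasBaireProperty (f : ℝ × ℝ → ℝ) : Prop :=
  ∀ U : Set ℝ, IsOpen U → BaireMeasurableSet (f ⁻¹' U)

/-- `A` contains a product of two (nonempty) perfect subsets of the line. -/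
def ContainsPerfectProduct (A : Set (ℝ × ℝ)) : Prop :=
  ∃ P Q : Set ℝ, Perfect P ∧ P.Nonempty ∧ Perfect Q ∧ Q.Nonempty ∧ P ×ˢ Q ⊆ A

/-- `A` has full outer Lebesgue measure in the plane: its trace on every Lebesgue measurable set `E`
has the same outer measure as `E` (equivalently, its complement has inner measure zero).
Here `volume` of an arbitrary set is its outer measure. -/
def HasFullOuterMeasure (A : Set (ℝ × ℝ)) : Prop :=
  ∀ E : Set (ℝ × ℝ), NullMeasurableSet E volume → volume (A ∩ E) = volume E

open Set TopologicalSpace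

open scoped ENNReal symmDiff

/-! ### Continuity on a residual set -/

section Continuity

/-! If `f` is continuous on `S` and `S` contains the grid `(u n, v m)`, its limit points `(u n, y)`
and `(x, y)`, then the iterated limit is `f (x, y)`. So it suffices to find large sets of continuity
that contain many such grids.

Category: `f` is continuous on a residual `G`, and Kuratowski–Ulam supplies the grids at generic
points. A fusion of finite grids in `G` with shrinking rectangles gives a perfect product inside any
residual subset of a nonempty open set.

Measure: Lusin gives a compact `K ⊆ B` of positive measure on which `f` is continuous, and Eggleston
gives `P ×ˢ Q ⊆ K`. Discarding the countably many points of `P` and `Q` isolated from the right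
leaves limits of strictly decreasing sequences. Full outer measure follows, since `FC f` meets every
set of positive measure. -/

theorem continuousOn_of_isTopologicalBasis {X Y : Type*} [TopologicalSpace X] [TopologicalSpace Y]
    {f : X → Y} {s : Set X} {b : Set (Set Y)} (hb : IsTopologicalBasis b) (O : Set Y → Set X)
    (hO : ∀ U ∈ b, IsOpen (O U)) (h : ∀ x ∈ s, ∀ U ∈ b, f x ∈ U ↔ x ∈ O U) : ContinuousOn f s := by
  intro x hx
  rw [ContinuousWithinAt, hb.nhds_hasBasis.tendsto_right_iff]
  rintro U ⟨hU, hxU⟩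
  have hxO : x ∈ O U := (h x hx U hU).1 hxU
  filter_upwards [self_mem_nhdsWithin, mem_nhdsWithin_of_mem_nhds ((hO U hU).mem_nhds hxO)]
    with y hy hyO using (h y hy U hU).2 hyO

/-- A function with the Baire property is continuous on a residual set. -/
theorem HasBaireProperty.exists_mem_residual_continuousOn {f : ℝ × ℝ → ℝ}
    (hf : HasBaireProperty f) : ∃ G ∈ residual (ℝ × ℝ), ContinuousOn f G := by
  have hb := isBasis_countableBasis ℝ
  have h : ∀ U ∈ countableBasis ℝ, ∃ O : Set (ℝ × ℝ), IsOpen O ∧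
      ∀ᶠ z in residual (ℝ × ℝ), f z ∈ U ↔ z ∈ O := fun U hU => by
    obtain ⟨O, hO, h⟩ := (hf U (hb.isOpen hU)).residualEq_isOpen
    exact ⟨O, hO, eventuallyEq_set.1 h⟩
  choose! O hO hfO using h
  exact ⟨_, (eventually_countable_ball (countable_countableBasis ℝ)).2 hfO,
    continuousOn_of_isTopologicalBasis hb O hO fun _ hx => hx⟩

end Continuity

/-! ### The Kuratowski–Ulam theorem -/

section KuratowskiUlam

variable {X Y : Type*} [TopologicalSpace X] [TopologicalSpace Y]

/-- Density of a section need only be tested on countably many basic sets `V`, and the projection of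
`t ∩ (X × V)` is open and dense. -/
theorem IsOpen.eventually_residual_residual_prodMk [SecondCountableTopology Y] {t : Set (X × Y)}
    (ho : IsOpen t) (hd : Dense t) :
    ∀ᶠ x in residual X, ∀ᶠ y in residual Y, (x, y) ∈ t := by
  have hb := isBasis_countableBasis Y
  have key : ∀ V ∈ countableBasis Y, ∀ᶠ x in residual X, ∃ y ∈ V, (x, y) ∈ t := by
    intro V hV
    have hVo := hb.isOpen hV
    refine residual_of_dense_open ?_ ?_
    · convert! isOpenMap_fst _ (ho.inter (isOpen_univ.prod hVo)) using 1
      ext x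
      simp [and_comm]
    · refine dense_iff_inter_open.2 fun U hU hne => ?_
      obtain ⟨⟨x, y⟩, ⟨hx, hy⟩, hxy⟩ := hd.inter_open_nonempty (U ×ˢ V) (hU.prod hVo)
        (hne.prod (nonempty_of_mem_countableBasis hV))
      exact ⟨x, hx, y, hy, hxy⟩
  filter_upwards [(eventually_countable_ball (countable_countableBasis Y)).2 key] with x hx
  refine residual_of_dense_open (ho.preimage (by fun_prop : Continuous fun y : Y => (x, y))) ?_
  refine hb.dense_iff.2 fun V hV _ => ?_
  obtain ⟨y, hy, hxy⟩ := hx V hV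
  exact ⟨y, hy, hxy⟩

/-- One direction of the **Kuratowski–Ulam theorem**. -/
theorem eventually_residual_residual_prodMk [SecondCountableTopology Y] {s : Set (X × Y)}
    (hs : s ∈ residual (X × Y)) : ∀ᶠ x in residual X, ∀ᶠ y in residual Y, (x, y) ∈ s := by
  obtain ⟨S, ho, hd, hc, hSs⟩ := mem_residual_iff.1 hs
  filter_upwards [(eventually_countable_ball hc).2
    fun t ht => (ho t ht).eventually_residual_residual_prodMk (hd t ht)] with x hx
  filter_upwards [(eventually_countable_ball hc).2 hx] with y hy using hSs hy

theorem eventually_residual_residual_prodMk_swap [SecondCountableTopology X] {s : Set (X × Y)}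
    (hs : s ∈ residual (X × Y)) : ∀ᶠ y in residual Y, ∀ᶠ x in residual X, (x, y) ∈ s :=
  eventually_residual_residual_prodMk
    (tendsto_residual_of_isOpenMap continuous_swap (Homeomorph.prodComm Y X).isOpenMap hs)

end KuratowskiUlam

/-! ### Grids at points of continuity -/

section FeebleContinuity

theorem feeblyContinuousAt_of_continuousOn {f : ℝ × ℝ → ℝ} {S : Set (ℝ × ℝ)}
    (hf : ContinuousOn f S) {z : ℝ × ℝ} (hz : z ∈ S) {u v : ℕ → ℝ}
    (hu : StrictAnti u) (hux : Tendsto u atTop (𝓝 z.1)) (hv : StrictAnti v)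
    (hvy : Tendsto v atTop (𝓝 z.2)) (huS : ∀ n, (u n, z.2) ∈ S) (huvS : ∀ n m, (u n, v m) ∈ S) :
    FeeblyContinuousAt f z := by
  refine ⟨u, v, hu, hux, hv, hvy, fun n => f (u n, z.2), fun n => ?_, ?_⟩
  · exact (hf _ (huS n)).tendsto.comp (tendsto_nhdsWithin_iff.2
      ⟨tendsto_const_nhds.prodMk_nhds hvy, .of_forall fun m => huvS n m⟩)
  · exact (hf z hz).tendsto.comp (tendsto_nhdsWithin_iff.2
      ⟨hux.prodMk_nhds tendsto_const_nhds, .of_forall huS⟩)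

theorem mem_residual_FC_of_continuousOn {f : ℝ × ℝ → ℝ} {G : Set (ℝ × ℝ)}
    (hG : G ∈ residual (ℝ × ℝ)) (hf : ContinuousOn f G) : FC f ∈ residual (ℝ × ℝ) := by
  have hsec : ∀ᶠ z in residual (ℝ × ℝ), ∀ᶠ x in residual ℝ, (x, z.2) ∈ G :=
    tendsto_residual_of_isOpenMap continuous_snd isOpenMap_snd
      (eventually_residual_residual_prodMk_swap hG)
  filter_upwards [hG, hsec] with z hz hz'
  obtain ⟨u, hu, huG, hux⟩ := (dense_of_mem_residual
    (hz'.and (eventually_residual_residual_prodMk hG))).exists_seq_strictAnti_tendsto z.1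
  -- With `u` fixed, only countably many residual conditions bear on `v`.
  obtain ⟨v, hv, hvG, hvy⟩ := (dense_of_mem_residual
    (eventually_countable_forall.2 fun n => (huG n).2.2)).exists_seq_strictAnti_tendsto z.2
  exact feeblyContinuousAt_of_continuousOn hf hz hu hux hv hvy (fun n => (huG n).2.1)
    fun n m => (hvG m).2 n

end FeebleContinuity

/-! ### Perfect products in residual sets -/

section PerfectProduct

theorem perfect_closure_iUnion_of_forall_exists_dist_lt {X : Type*} [MetricSpace X]
    {F : ℕ → Set X} (hF : Monotone F)
    (h : ∀ n, ∀ x ∈ F n, ∃ y ∈ F (n + 1), y ≠ x ∧ dist y x < 1 / ((n : ℝ) + 1)) :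
    Perfect (closure (⋃ n, F n)) := by
  refine Preperfect.perfect_closure (preperfect_iff_nhds.2 fun x hx U hU => ?_)
  obtain ⟨n, hn⟩ := mem_iUnion.1 hx
  obtain ⟨ε, hε, hεU⟩ := Metric.mem_nhds_iff.1 hU
  obtain ⟨N, hN⟩ := exists_nat_one_div_lt hε
  -- By monotonicity `x` survives to stage `max n N`, where neighbours are within `1 / (N + 1)`.
  obtain ⟨y, hy, hne, hd⟩ := h (max n N) x (hF (le_max_left _ _) hn)
  refine ⟨y, ⟨hεU (hd.trans (lt_of_le_of_lt ?_ hN)), mem_iUnion.2 ⟨_, hy⟩⟩, hne⟩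
  exact one_div_le_one_div_of_le (by positivity) (by gcongr; exact le_max_right _ _)

theorem exists_mem_ne_of_mem_residual {T : Set ℝ} (hT : T ∈ residual ℝ) {x : ℝ} {N : Set ℝ}
    (hN : N ∈ 𝓝 x) : ∃ y ∈ T, y ∈ N ∧ y ≠ x := by
  obtain ⟨y, ⟨hyT, hyx⟩, hyN⟩ :=
    ((dense_of_mem_residual hT).sdiff_singleton x).inter_nhds_nonempty hN
  exact ⟨y, hyT, hyN, hyx⟩

/-- A finite approximation, together with open neighbourhoods confining the later ones, to a product
of perfect sets inside `G`. -/
structure ProductApprox (G : Set (ℝ × ℝ)) where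
  F : Finset ℝ
  H : Finset ℝ
  V : Set ℝ
  W : Set ℝ
  isOpen_V : IsOpen V
  isOpen_W : IsOpen W
  F_subset : (F : Set ℝ) ⊆ V
  H_subset : (H : Set ℝ) ⊆ W
  eventually_F : ∀ x ∈ F, ∀ᶠ y in residual ℝ, (x, y) ∈ G
  eventually_H : ∀ y ∈ H, ∀ᶠ x in residual ℝ, (x, y) ∈ G
  prod_mem : ∀ x ∈ F, ∀ y ∈ H, (x, y) ∈ G

/-- `t` extends `s`: every point of `s` gets a new neighbour at distance less than `ε`, and the
confining rectangle shrinks into `U`. -/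
structure ProductApprox.Extends {G : Set (ℝ × ℝ)} (s t : ProductApprox G) (U : Set (ℝ × ℝ))
    (ε : ℝ) : Prop where
  F_subset : s.F ⊆ t.F
  H_subset : s.H ⊆ t.H
  V_subset : t.V ⊆ s.V
  W_subset : t.W ⊆ s.W
  closure_subset : closure t.V ×ˢ closure t.W ⊆ U
  exists_F : ∀ x ∈ s.F, ∃ y ∈ t.F, y ≠ x ∧ dist y x < ε
  exists_H : ∀ x ∈ s.H, ∃ y ∈ t.H, y ≠ x ∧ dist y x < ε

theorem exists_isOpen_closure_prod_subset {F H : Finset ℝ} {V W : Set ℝ} {U : Set (ℝ × ℝ)}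
    (hV : IsOpen V) (hW : IsOpen W) (hU : IsOpen U) (hF : (F : Set ℝ) ⊆ V) (hH : (H : Set ℝ) ⊆ W)
    (hFH : (F : Set ℝ) ×ˢ (H : Set ℝ) ⊆ U) :
    ∃ V' W' : Set ℝ, IsOpen V' ∧ IsOpen W' ∧ (F : Set ℝ) ⊆ V' ∧ (H : Set ℝ) ⊆ W' ∧ V' ⊆ V ∧
      W' ⊆ W ∧ closure V' ×ˢ closure W' ⊆ U := by
  have hFc := F.finite_toSet.isCompact
  have hHc := H.finite_toSet.isCompact
  obtain ⟨A, B, hA, hB, hFA, hHB, hAB⟩ := generalized_tube_lemma hFc hHc hU hFH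
  obtain ⟨V', hV', hFV', hclV'⟩ := hFc.exists_isOpen_closure_subset
    ((hA.inter hV).mem_nhdsSet.2 (subset_inter hFA hF))
  obtain ⟨W', hW', hHW', hclW'⟩ := hHc.exists_isOpen_closure_subset
    ((hB.inter hW).mem_nhdsSet.2 (subset_inter hHB hH))
  exact ⟨V', W', hV', hW', hFV', hHW', fun x hx => (hclV' (subset_closure hx)).2,
    fun x hx => (hclW' (subset_closure hx)).2,
    (prod_mono (fun x hx => (hclV' hx).1) fun x hx => (hclW' hx).1).trans hAB⟩

theorem ProductApprox.exists_extends {G : Set (ℝ × ℝ)} (hG : G ∈ residual (ℝ × ℝ))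
    (s : ProductApprox G) {U : Set (ℝ × ℝ)} (hU : IsOpen U) (hGU : G ⊆ U) {ε : ℝ} (hε : 0 < ε) :
    ∃ t : ProductApprox G, s.Extends t U ε := by
  classical
  have hF : ∀ x ∈ s.F, ∃ x', ((∀ y ∈ s.H, (x', y) ∈ G) ∧ ∀ᶠ y in residual ℝ, (x', y) ∈ G) ∧
      (x' ∈ s.V ∧ dist x' x < ε) ∧ x' ≠ x := fun x hx =>
    exists_mem_ne_of_mem_residual (((Filter.eventually_all_finset s.H).2 s.eventually_H).and
      (eventually_residual_residual_prodMk hG))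
      (inter_mem (s.isOpen_V.mem_nhds (s.F_subset hx)) (Metric.ball_mem_nhds x hε))
  choose! c hcG hcd hcne using hF
  set F' := s.F ∪ s.F.image c with hF'
  have hF'e : ∀ x ∈ F', ∀ᶠ y in residual ℝ, (x, y) ∈ G := by
    simp only [hF', Finset.mem_union, Finset.mem_image]
    rintro x (hx | ⟨x, hx, rfl⟩)
    exacts [s.eventually_F x hx, (hcG x hx).2]
  have hF'H : ∀ x ∈ F', ∀ y ∈ s.H, (x, y) ∈ G := by
    simp only [hF', Finset.mem_union, Finset.mem_image]
    rintro x (hx | ⟨x, hx, rfl⟩)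
    exacts [s.prod_mem x hx, (hcG x hx).1]
  have hF'V : (F' : Set ℝ) ⊆ s.V := by
    simp only [hF', Finset.coe_union, Finset.coe_image, union_subset_iff, image_subset_iff]
    exact ⟨s.F_subset, fun x hx => (hcd x hx).1⟩
  -- The ordinates are chosen generic against the enlarged `F'`, so pairs of two new coordinates
  -- also lie in `G`.
  have hH : ∀ y ∈ s.H, ∃ y', ((∀ x ∈ F', (x, y') ∈ G) ∧ ∀ᶠ x in residual ℝ, (x, y') ∈ G) ∧
      (y' ∈ s.W ∧ dist y' y < ε) ∧ y' ≠ y := fun y hy =>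
    exists_mem_ne_of_mem_residual (((Filter.eventually_all_finset F').2 hF'e).and
      (eventually_residual_residual_prodMk_swap hG))
      (inter_mem (s.isOpen_W.mem_nhds (s.H_subset hy)) (Metric.ball_mem_nhds y hε))
  choose! d hdG hdd hdne using hH
  set H' := s.H ∪ s.H.image d with hH'
  have hH'e : ∀ y ∈ H', ∀ᶠ x in residual ℝ, (x, y) ∈ G := by
    simp only [hH', Finset.mem_union, Finset.mem_image]
    rintro x (hx | ⟨x, hx, rfl⟩)
    exacts [s.eventually_H x hx, (hdG x hx).2]
  have hF'H' : ∀ x ∈ F', ∀ y ∈ H', (x, y) ∈ G := by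
    intro x hx
    simp only [hH', Finset.mem_union, Finset.mem_image]
    rintro y (hy | ⟨y, hy, rfl⟩)
    exacts [hF'H x hx y hy, (hdG y hy).1 x hx]
  have hH'W : (H' : Set ℝ) ⊆ s.W := by
    simp only [hH', Finset.coe_union, Finset.coe_image, union_subset_iff, image_subset_iff]
    exact ⟨s.H_subset, fun x hx => (hdd x hx).1⟩
  obtain ⟨V', W', hV', hW', hFV', hHW', hVV', hWW', hcl⟩ := exists_isOpen_closure_prod_subset
    s.isOpen_V s.isOpen_W hU hF'V hH'W fun z hz => hGU (hF'H' z.1 hz.1 z.2 hz.2)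
  refine ⟨⟨F', H', V', W', hV', hW', hFV', hHW', hF'e, hH'e, hF'H'⟩,
    ⟨Finset.subset_union_left, Finset.subset_union_left, hVV', hWW', hcl, ?_, ?_⟩⟩
  · exact fun x hx => ⟨c x, Finset.mem_union_right _ (Finset.mem_image_of_mem c hx), hcne x hx,
      (hcd x hx).2⟩
  · exact fun x hx => ⟨d x, Finset.mem_union_right _ (Finset.mem_image_of_mem d hx), hdne x hx,
      (hdd x hx).2⟩

/-- A residual subset of a nonempty open subset of the plane contains a product of two perfect
sets. -/
theorem containsPerfectProduct_inter_of_mem_residual {C O : Set (ℝ × ℝ)}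
    (hC : C ∈ residual (ℝ × ℝ)) (hO : IsOpen O) (hne : O.Nonempty) :
    ContainsPerfectProduct (C ∩ O) := by
  obtain ⟨G, hGC, hGδ, hGd⟩ := mem_residual.1 hC
  have hG : G ∈ residual (ℝ × ℝ) := mem_residual.2 ⟨G, subset_rfl, hGδ, hGd⟩
  obtain ⟨U, hUo, rfl⟩ := hGδ.eq_iInter_nat
  obtain ⟨⟨a, b⟩, hab⟩ := hne
  obtain ⟨A, hA, B, hB, hABO⟩ := mem_nhds_prod_iff.1 (hO.mem_nhds hab)
  obtain ⟨x, hx, hxA, -⟩ := exists_mem_ne_of_mem_residual (eventually_residual_residual_prodMk hG) hA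
  replace hx : ∀ᶠ y in residual ℝ, (x, y) ∈ ⋂ n, U n := hx
  obtain ⟨y, ⟨hxy, hy⟩, hyB, -⟩ := exists_mem_ne_of_mem_residual
    (hx.and (eventually_residual_residual_prodMk_swap hG)) hB
  obtain ⟨V, W, hV, hW, hxV, hyW, -, -, hVW⟩ := exists_isOpen_closure_prod_subset (F := {x}) (H := {y})
    isOpen_univ isOpen_univ hO (subset_univ _) (subset_univ _)
    (by simpa using hABO (mk_mem_prod hxA hyB))
  let s₀ : ProductApprox (⋂ n, U n) := ⟨{x}, {y}, V, W, hV, hW, hxV, hyW, by simpa using hx,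
    by simpa using hy, by simpa using hxy⟩
  choose next hnext using fun (n : ℕ) (s : ProductApprox (⋂ n, U n)) =>
    s.exists_extends hG (hUo n) (iInter_subset U n) (ε := 1 / ((n : ℝ) + 1)) (by positivity)
  let s : ℕ → ProductApprox (⋂ n, U n) := fun n => Nat.rec s₀ next n
  have hs : ∀ n, (s n).Extends (s (n + 1)) (U n) (1 / ((n : ℝ) + 1)) := fun n => hnext n (s n)
  have hF : Monotone fun n => ((s n).F : Set ℝ) :=
    monotone_nat_of_le_succ fun n => Finset.coe_subset.2 (hs n).F_subset
  have hH : Monotone fun n => ((s n).H : Set ℝ) :=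
    monotone_nat_of_le_succ fun n => Finset.coe_subset.2 (hs n).H_subset
  have hVs : Antitone fun n => (s n).V := antitone_nat_of_succ_le fun n => (hs n).V_subset
  have hWs : Antitone fun n => (s n).W := antitone_nat_of_succ_le fun n => (hs n).W_subset
  have hP : ∀ n, closure (⋃ k, ((s k).F : Set ℝ)) ⊆ closure (s n).V := fun n =>
    closure_mono (iUnion_subset fun k => (hF (le_max_left k n)).trans
      ((s _).F_subset.trans (hVs (le_max_right k n))))
  have hQ : ∀ n, closure (⋃ k, ((s k).H : Set ℝ)) ⊆ closure (s n).W := fun n =>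
    closure_mono (iUnion_subset fun k => (hH (le_max_left k n)).trans
      ((s _).H_subset.trans (hWs (le_max_right k n))))
  refine ⟨closure (⋃ n, ((s n).F : Set ℝ)), closure (⋃ n, ((s n).H : Set ℝ)),
    perfect_closure_iUnion_of_forall_exists_dist_lt hF fun n => (hs n).exists_F,
    ⟨x, subset_closure (mem_iUnion.2 ⟨0, ?_⟩)⟩,
    perfect_closure_iUnion_of_forall_exists_dist_lt hH fun n => (hs n).exists_H,
    ⟨y, subset_closure (mem_iUnion.2 ⟨0, ?_⟩)⟩,
    subset_inter ?_ ((prod_mono (hP 0) (hQ 0)).trans hVW)⟩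
  · simp [s, s₀]
  · simp [s, s₀]
  -- Confinement in `U n` is achieved at stage `n + 1`; stage `0` only confines to `O`.
  · refine (subset_iInter fun n => ?_).trans hGC
    exact (prod_mono (hP (n + 1)) (hQ (n + 1))).trans (hs n).closure_subset

end PerfectProduct

theorem HasBaireProperty.mem_residual_FC {f : ℝ × ℝ → ℝ} (hf : HasBaireProperty f) :
    FC f ∈ residual (ℝ × ℝ) :=
  let ⟨_, hG, hfG⟩ := hf.exists_mem_residual_continuousOn
  mem_residual_FC_of_continuousOn hG hfG

theorem BaireMeasurableSet.containsPerfectProduct_inter {B C : Set (ℝ × ℝ)}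
    (hB : BaireMeasurableSet B) (hBm : ¬ IsMeagre B) (hC : C ∈ residual (ℝ × ℝ)) :
    ContainsPerfectProduct (C ∩ B) := by
  obtain ⟨O, hO, hBO⟩ := hB.residualEq_isOpen
  have hne : O.Nonempty := by
    by_contra h
    rw [not_nonempty_iff_eq_empty.1 h] at hBO
    exact hBm (by filter_upwards [eventuallyEq_set.1 hBO] with z hz hzB using hz.1 hzB)
  obtain ⟨P, Q, hP, hPne, hQ, hQne, h⟩ := containsPerfectProduct_inter_of_mem_residual
    (inter_mem hC (eventuallyEq_set.1 hBO)) hO hne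
  exact ⟨P, Q, hP, hPne, hQ, hQne, fun z hz => ⟨(h hz).1.1, (h hz).1.2.2 (h hz).2⟩⟩

/-! ### Lusin's theorem -/

section Lusin

variable {α : Type*} [MeasurableSpace α] {μ : Measure α}

theorem MeasureTheory.NullMeasurableSet.exists_isCompact_measure_diff_lt [TopologicalSpace α]
    [T2Space α] [OpensMeasurableSpace α] [μ.InnerRegularCompactLTTop] {A : Set α}
    (hA : NullMeasurableSet A μ) (hfin : μ A ≠ ∞) {ε : ℝ≥0∞} (hε : ε ≠ 0) :
    ∃ K ⊆ A, IsCompact K ∧ μ (A \ K) < ε := by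
  obtain ⟨E, hEA, hE, hEae⟩ := hA.exists_measurable_subset_ae_eq
  obtain ⟨K, hKE, hK, hlt⟩ := hE.exists_isCompact_sdiff_lt (by rwa [measure_congr hEae]) hε
  exact ⟨K, hKE.trans hEA, hK,
    (measure_congr (hEae.diff (ae_eq_refl K))).symm.trans_lt hlt⟩

/-- A weak form of **Lusin's theorem**. -/
theorem MeasureTheory.NullMeasurable.exists_isCompact_continuousOn [TopologicalSpace α]
    [T2Space α] [OpensMeasurableSpace α] [μ.InnerRegularCompactLTTop] [IsFiniteMeasureOnCompacts μ]
    {Y : Type*} [TopologicalSpace Y] [SecondCountableTopology Y] [MeasurableSpace Y]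
    [OpensMeasurableSpace Y] {f : α → Y} (hf : NullMeasurable f μ) {B : Set α} (hB : IsCompact B)
    (hpos : 0 < μ B) : ∃ K ⊆ B, IsCompact K ∧ 0 < μ K ∧ ContinuousOn f K := by
  have hBm := hB.measurableSet
  have hBfin : μ B ≠ ∞ := hB.measure_lt_top.ne
  have hb := isBasis_countableBasis Y
  have : Countable (countableBasis Y) := (countable_countableBasis Y).to_subtype
  -- The total loss stays below `μ B`; each `ε U` is split between approximating `f ⁻¹' U` and its
  -- complement within `B`.
  obtain ⟨ε, hε, hεsum⟩ := ENNReal.exists_pos_sum_of_countable' hpos.ne' (countableBasis Y)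
  have hUm : ∀ U : countableBasis Y, NullMeasurableSet (f ⁻¹' U) μ := fun U =>
    hf (hb.isOpen U.2).measurableSet
  have h2 : ∀ U : countableBasis Y, ε U / 2 ≠ 0 := fun U => by simpa using (hε U).ne'
  choose C hCB hCc hC using fun U : countableBasis Y =>
    (hBm.nullMeasurableSet.inter (hUm U)).exists_isCompact_measure_diff_lt
      (measure_ne_top_of_subset inter_subset_left hBfin) (h2 U)
  choose D hDB hDc hD using fun U : countableBasis Y =>
    (hBm.nullMeasurableSet.diff (hUm U)).exists_isCompact_measure_diff_lt
      (measure_ne_top_of_subset sdiff_subset hBfin) (h2 U)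
  have hcl : IsClosed (⋂ U, (C U ∪ D U)) :=
    isClosed_iInter fun U => (hCc U).isClosed.union (hDc U).isClosed
  refine ⟨B ∩ ⋂ U, (C U ∪ D U), inter_subset_left, hB.inter_right hcl, ?_, ?_⟩
  · by_contra h0
    have hsub : B ⊆ (B ∩ ⋂ U, (C U ∪ D U)) ∪
        ⋃ U : countableBasis Y, ((B ∩ f ⁻¹' U) \ C U ∪ (B \ f ⁻¹' U) \ D U) := by
      intro x hx
      by_cases h : x ∈ ⋂ U, (C U ∪ D U)
      · exact .inl ⟨hx, h⟩
      · simp only [mem_iInter, not_forall, mem_union, not_or] at h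
        obtain ⟨U, hU1, hU2⟩ := h
        refine .inr (mem_iUnion.2 ⟨U, ?_⟩)
        by_cases hfx : f x ∈ (U : Set Y)
        exacts [.inl ⟨⟨hx, hfx⟩, hU1⟩, .inr ⟨⟨hx, hfx⟩, hU2⟩]
    refine lt_irrefl (μ B) ?_
    calc μ B ≤ μ (B ∩ ⋂ U, (C U ∪ D U)) +
          μ (⋃ U : countableBasis Y, ((B ∩ f ⁻¹' U) \ C U ∪ (B \ f ⁻¹' U) \ D U)) :=
          (measure_mono hsub).trans (measure_union_le _ _)
      _ ≤ 0 + ∑' U, (ε U / 2 + ε U / 2) :=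
          add_le_add (not_lt.1 h0) ((measure_iUnion_le _).trans (ENNReal.tsum_le_tsum fun U =>
            (measure_union_le _ _).trans (add_le_add (hC U).le (hD U).le)))
      _ = ∑' U, ε U := by simp [ENNReal.add_halves]
      _ < μ B := hεsum
  · classical
    -- On the compact set constructed, `f ⁻¹' U` agrees with the open set `(D U)ᶜ`.
    refine continuousOn_of_isTopologicalBasis hb
      (fun U => if hU : U ∈ countableBasis Y then (D ⟨U, hU⟩)ᶜ else ∅) (fun U hU => ?_)
      fun x hx U hU => ?_
    · simpa [hU] using (hDc ⟨U, hU⟩).isClosed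
    · have hCD := mem_iInter.1 hx.2 ⟨U, hU⟩
      simp only [hU, dif_pos, mem_compl_iff]
      exact ⟨fun h hxD => (hDB _ hxD).2 h, fun h => (hCB _ (hCD.resolve_right h)).2⟩

end Lusin

/-! ### Condensation points -/

section Condensation

/-- Cantor–Bendixson: the non-condensation points of `A` are covered by countably many countable
sets, so removing them spoils no uncountable trace. -/
theorem exists_subset_forall_nhds_not_countable {X Y : Type*} [TopologicalSpace Y]
    [SecondCountableTopology Y] (φ : X → Y) {A : Set X} (hA : ¬ A.Countable) :
    ∃ A' ⊆ A, A'.Nonempty ∧ ∀ x ∈ A', ∀ U ∈ 𝓝 (φ x), ¬ (A' ∩ φ ⁻¹' U).Countable := by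
  have hb := isBasis_countableBasis Y
  set A' : Set X := {x | x ∈ A ∧ ∀ U ∈ 𝓝 (φ x), ¬ (A ∩ φ ⁻¹' U).Countable} with hA'
  have hdiff : (A \ A').Countable := by
    have hc : (⋃ U ∈ {U ∈ countableBasis Y | (A ∩ φ ⁻¹' U).Countable}, A ∩ φ ⁻¹' U).Countable :=
      ((countable_countableBasis Y).mono fun _ h => h.1).biUnion fun U hU => hU.2
    refine hc.mono fun x hx => ?_
    have : ∃ U ∈ 𝓝 (φ x), (A ∩ φ ⁻¹' U).Countable := by
      by_contra! h
      exact hx.2 ⟨hx.1, h⟩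
    obtain ⟨U, hU, hUc⟩ := this
    obtain ⟨V, hV, hxV, hVU⟩ := hb.mem_nhds_iff.1 hU
    exact mem_biUnion (⟨hV, hUc.mono (inter_subset_inter_right _ (preimage_mono hVU))⟩ :
      V ∈ {U ∈ countableBasis Y | (A ∩ φ ⁻¹' U).Countable}) ⟨hx.1, hxV⟩
  refine ⟨A', fun x hx => hx.1, ?_, fun x hx U hU hc => hx.2 U hU ?_⟩
  · by_contra h
    rw [not_nonempty_iff_eq_empty.1 h, sdiff_empty] at hdiff
    exact hA hdiff
  · refine (hc.union hdiff).mono fun y hy => ?_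
    by_cases hyA : y ∈ A'
    exacts [.inl ⟨hyA, hy.2⟩, .inr ⟨hy.1, hyA⟩]

/-- An uncountable family of sets of finite measure has an uncountable subfamily whose members
are approximated, in index and in measure, by other members of the subfamily. -/
theorem exists_subset_forall_exists_measure_diff_lt {β : Type*} [MeasurableSpace β]
    {ν : Measure β} [IsSeparable ν] {S : ℝ → Set β}
    (hS : ∀ x, MeasurableSet (S x)) (hfin : ∀ x, ν (S x) ≠ ∞) {A : Set ℝ} (hA : ¬ A.Countable) :
    ∃ A' ⊆ A, A'.Nonempty ∧ ∀ x ∈ A', ∀ ε > 0, ∀ δ > 0,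
      ∃ y ∈ A', y ≠ x ∧ dist y x < ε ∧ ν (S x \ S y) < δ := by
  have : Fact ((1 : ℝ≥0∞) ≠ ∞) := ⟨ENNReal.one_ne_top⟩
  -- Condensation in the separable space `ℝ × L¹` controls the index and the measure of the
  -- symmetric difference at once.
  let φ : ℝ → ℝ × Lp ℝ 1 ν := fun x => (x, indicatorConstLp 1 (hS x) (hfin x) 1)
  obtain ⟨A', hA'A, hne, h⟩ := exists_subset_forall_nhds_not_countable φ hA
  refine ⟨A', hA'A, hne, fun x hx ε hε δ hδ => ?_⟩
  have hU : Metric.ball x ε ×ˢ Metric.eball (φ x).2 δ ∈ 𝓝 (φ x) :=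
    prod_mem_nhds (Metric.ball_mem_nhds _ hε) (Metric.eball_mem_nhds _ hδ)
  obtain ⟨y, ⟨hyA', hyε, hyδ⟩, hyx⟩ : ((A' ∩ φ ⁻¹' _) \ {x}).Nonempty := by
    by_contra hemp
    exact h x hx _ hU ((countable_singleton x).mono
      (sdiff_eq_empty.1 (not_nonempty_iff_eq_empty.1 hemp)))
  rw [Metric.mem_eball, edist_indicatorConstLp_eq_enorm, ← ofReal_norm,
    norm_indicatorConstLp one_ne_zero ENNReal.one_ne_top] at hyδ
  simp only [norm_one, ENNReal.toReal_one, div_one, Real.rpow_one, one_mul] at hyδ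
  rw [ofReal_measureReal (by finiteness [hfin x, hfin y])] at hyδ
  exact ⟨y, hyA', hyx, hyε, (measure_mono subset_union_right).trans_lt hyδ⟩

end Condensation

/-! ### Perfect products in sets of positive measure -/

section PerfectProduct

theorem exists_finset_superset_forall_exists_near {S : ℝ → Set ℝ} (hS : ∀ x, MeasurableSet (S x))
    {A : Set ℝ} (hA : ∀ x ∈ A, ∀ ε > 0, ∀ δ > 0,
      ∃ y ∈ A, y ≠ x ∧ dist y x < ε ∧ volume (S x \ S y) < δ) {c : ℝ≥0∞} {F : Finset ℝ}
    (hFA : (F : Set ℝ) ⊆ A) (hF : c < volume (⋂ x ∈ F, S x)) {ε : ℝ} (hε : 0 < ε) :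
    ∃ F' : Finset ℝ, F ⊆ F' ∧ (F' : Set ℝ) ⊆ A ∧ c < volume (⋂ x ∈ F', S x) ∧
      ∀ x ∈ F, ∃ y ∈ F', y ≠ x ∧ dist y x < ε := by
  classical
  suffices H : ∀ T ⊆ F, ∃ F' : Finset ℝ, F ⊆ F' ∧ (F' : Set ℝ) ⊆ A ∧ c < volume (⋂ x ∈ F', S x) ∧
      ∀ x ∈ T, ∃ y ∈ F', y ≠ x ∧ dist y x < ε from H F subset_rfl
  intro T
  induction T using Finset.induction_on with
  | empty => exact fun _ => ⟨F, subset_rfl, hFA, hF, by simp⟩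
  | insert x T _ ih =>
    intro hT
    rw [Finset.insert_subset_iff] at hT
    obtain ⟨F', hFF', hF'A, hc, hnear⟩ := ih hT.2
    -- The tolerance is the current slack above `c`: the intersection lies in `S x`, so adding `y`
    -- costs at most the measure of `S x \ S y`.
    obtain ⟨y, hyA, hyx, hyε, hyδ⟩ := hA x (hFA hT.1) ε hε _ (tsub_pos_of_lt hc)
    refine ⟨insert y F', hFF'.trans (Finset.subset_insert _ _), ?_, ?_, ?_⟩
    · rw [Finset.coe_insert, insert_subset_iff]
      exact ⟨hyA, hF'A⟩
    · rw [Finset.set_biInter_insert, inter_comm]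
      by_contra! hle
      have hsub : (⋂ z ∈ F', S z) \ S y ⊆ S x \ S y :=
        sdiff_subset_sdiff_left (biInter_subset_of_mem (hFF' hT.1))
      have h1 := lt_tsub_iff_left.1 ((measure_mono hsub).trans_lt hyδ)
      rw [← measure_inter_add_sdiff (⋂ z ∈ F', S z) (hS y)] at h1
      exact (add_le_add hle le_rfl).not_gt h1
    · intro z hz
      rcases Finset.mem_insert.1 hz with rfl | hz
      · exact ⟨y, Finset.mem_insert_self _ _, hyx, hyε⟩
      · obtain ⟨w, hw, h⟩ := hnear z hz
        exact ⟨w, Finset.mem_insert_of_mem hw, h⟩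

/-- **Eggleston's theorem** (weak form): a compact subset of the plane of positive measure contains
a product of two perfect sets. -/
theorem IsCompact.containsPerfectProduct_of_volume_pos {K : Set (ℝ × ℝ)} (hK : IsCompact K)
    (hpos : 0 < volume K) : ContainsPerfectProduct K := by
  let S : ℝ → Set ℝ := fun x => Prod.mk x ⁻¹' K
  have hScl : ∀ x, IsClosed (S x) := fun x => hK.isClosed.preimage (by fun_prop)
  have hSm : ∀ x, MeasurableSet (S x) := fun x => (hScl x).measurableSet
  have hSfin : ∀ x, volume (S x) ≠ ∞ := fun x => by
    refine ((hK.image continuous_snd).of_isClosed_subset (hScl x) ?_).measure_lt_top.ne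
    exact fun y hy => ⟨(x, y), hy, rfl⟩
  have hA : ¬ {x | volume (S x) ≠ 0}.Countable := fun hc => by
    refine hpos.ne' ?_
    rw [Measure.volume_eq_prod, Measure.measure_prod_null hK.measurableSet]
    exact hc.measure_zero volume
  obtain ⟨A, hA0, ⟨x₀, hx₀⟩, hA⟩ := exists_subset_forall_exists_measure_diff_lt hSm hSfin hA
  -- A bound `c > 0` kept at every stage survives the infinite intersection, which is therefore
  -- uncountable.
  obtain ⟨c, hc0, hc⟩ := exists_between (pos_iff_ne_zero.2 (hA0 hx₀))
  let σ := {F : Finset ℝ // (F : Set ℝ) ⊆ A ∧ c < volume (⋂ x ∈ F, S x)}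
  have hstep : ∀ (n : ℕ) (F : σ), ∃ F' : σ, F.1 ⊆ F'.1 ∧
      ∀ x ∈ F.1, ∃ y ∈ F'.1, y ≠ x ∧ dist y x < 1 / ((n : ℝ) + 1) := fun n F => by
    obtain ⟨F', hFF', hF'A, hc, h⟩ := exists_finset_superset_forall_exists_near hSm hA F.2.1 F.2.2
      (ε := 1 / ((n : ℝ) + 1)) (by positivity)
    exact ⟨⟨F', hF'A, hc⟩, hFF', h⟩
  choose next hsub hnext using hstep
  let F : ℕ → σ := fun n => Nat.rec ⟨{x₀}, by simpa using hx₀, by simpa using hc⟩ next n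
  have hF : Monotone fun n => ((F n).1 : Set ℝ) :=
    monotone_nat_of_le_succ fun n => Finset.coe_subset.2 (hsub n (F n))
  let D : Set ℝ := ⋃ n, ((F n).1 : Set ℝ)
  have hDS : ⋂ x ∈ D, S x = ⋂ n, ⋂ x ∈ (F n).1, S x := biInter_iUnion _ _
  have hvol : c ≤ volume (⋂ x ∈ D, S x) := by
    rw [hDS, Antitone.measure_iInter (s := fun n => ⋂ x ∈ (F n).1, S x)
      (fun m n h => biInter_mono (hF h) fun _ _ => subset_rfl)
      (fun n => (Finset.measurableSet_biInter _ fun x _ => hSm x).nullMeasurableSet)]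
    · exact le_iInf fun n => (F n).2.2.le
    · exact ⟨0, by simpa [F] using hSfin x₀⟩
  obtain ⟨Q, hQ, hQne, hQS⟩ := exists_perfect_nonempty_of_isClosed_of_not_countable
    (isClosed_biInter fun x (_ : x ∈ D) => hScl x)
    fun hcount => (hc0.trans_le hvol).ne' (hcount.measure_zero volume)
  refine ⟨closure D, Q, perfect_closure_iUnion_of_forall_exists_dist_lt hF fun n => hnext n (F n),
    ⟨x₀, subset_closure (mem_iUnion.2 ⟨0, by simp [F]⟩)⟩, hQ, hQne, ?_⟩
  rintro ⟨x, y⟩ ⟨hx, hy⟩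
  -- Horizontal sections of `K` are closed, so membership passes from `D` to its closure.
  exact closure_minimal (fun z hz => mem_iInter₂.1 (hQS hy) z hz)
    (hK.isClosed.preimage (by fun_prop : Continuous fun z : ℝ => (z, y))) hx

end PerfectProduct

/-! ### Accumulation from the right -/

section RightAccumulation

/-- A perfect set still contains a perfect set after the removal of countably many points. -/
theorem Perfect.exists_perfect_subset_diff_countable {X : Type*} [MetricSpace X] [CompleteSpace X]
    [SecondCountableTopology X] {P N : Set X} (hP : Perfect P) (hne : P.Nonempty)
    (hN : N.Countable) : ∃ P' ⊆ P \ N, Perfect P' ∧ P'.Nonempty := by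
  obtain ⟨g, hgP, hgc, hgi⟩ := hP.exists_nat_bool_injection hne
  -- The Cantor set splits into uncountably many disjoint Cantor slices, and a countable `N` misses
  -- one.
  let e : (ℕ → Bool) × (ℕ → Bool) ≃ₜ (ℕ → Bool) :=
    Homeomorph.sumArrowHomeomorphProdArrow.symm.trans
      (Homeomorph.piCongrLeft (Y := fun _ => Bool) Equiv.natSumNatEquivNat)
  let h : (ℕ → Bool) × (ℕ → Bool) → X := g ∘ e
  have hc : Continuous h := hgc.comp e.continuous
  have hi : Function.Injective h := hgi.comp e.injective
  have hunc : ¬ (univ : Set (ℕ → Bool)).Countable := fun hu => by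
    have := Cardinal.mk_le_aleph0_iff.2 (countable_univ_iff.1 hu)
    simp [Cardinal.aleph0_lt_continuum.not_ge] at this
  obtain ⟨a, ha⟩ : ∃ a, ∀ b, h (a, b) ∉ N := by
    by_contra! H
    refine hunc (((hN.preimage hi).image Prod.fst).mono fun a _ => ?_)
    obtain ⟨b, hb⟩ := H a
    exact ⟨(a, b), hb, rfl⟩
  have hia : Function.Injective fun b => h (a, b) := fun b b' hbb => (Prod.ext_iff.1 (hi hbb)).2
  obtain ⟨P', hP', hP'ne, hsub⟩ := exists_perfect_nonempty_of_isClosed_of_not_countable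
    (isCompact_range (hc.comp (by fun_prop : Continuous fun b : ℕ → Bool => (a, b)))).isClosed
    (fun hcount => hunc (by
      rw [← image_univ] at hcount
      exact countable_of_injective_of_countable_image hia.injOn hcount))
  refine ⟨P', fun x hx => ?_, hP', hP'ne⟩
  obtain ⟨b, rfl⟩ := hsub hx
  exact ⟨hgP ⟨_, rfl⟩, ha b⟩

theorem Perfect.exists_perfect_subset_forall_exists_strictAnti {P : Set ℝ} (hP : Perfect P)
    (hne : P.Nonempty) : ∃ P' ⊆ P, Perfect P' ∧ P'.Nonempty ∧
      ∀ x ∈ P', ∃ u : ℕ → ℝ, StrictAnti u ∧ (∀ n, u n ∈ P) ∧ Tendsto u atTop (𝓝 x) := by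
  obtain ⟨P', hP'P, hP', hP'ne⟩ := hP.exists_perfect_subset_diff_countable hne
    (countable_setOfPred_isolated_right_within (s := P))
  refine ⟨P', fun x hx => (hP'P hx).1, hP', hP'ne, fun x hx => ?_⟩
  have hx' : x ∈ closure (P ∩ Ioi x) := by
    rw [mem_closure_iff_nhdsWithin_neBot, neBot_iff]
    exact fun h => (hP'P hx).2 ⟨(hP'P hx).1, h⟩
  obtain ⟨u, hu, -, hux, huP⟩ := (isGLB_of_mem_closure (fun y hy => (mem_Ioi.1 hy.2).le)
    hx').exists_seq_strictAnti_tendsto_of_notMem (fun h => lt_irrefl x h.2)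
    (closure_nonempty_iff.1 ⟨x, hx'⟩)
  exact ⟨u, hu, fun n => (huP n).1, hux⟩

end RightAccumulation

/-! ### Conclusion in the measurable case -/

theorem ContinuousOn.containsPerfectProduct_FC_inter {f : ℝ × ℝ → ℝ} {K : Set (ℝ × ℝ)}
    (hf : ContinuousOn f K) (hK : ContainsPerfectProduct K) :
    ContainsPerfectProduct (FC f ∩ K) := by
  obtain ⟨P, Q, hP, hPne, hQ, hQne, hPQ⟩ := hK
  obtain ⟨P', hP'P, hP', hP'ne, hPu⟩ := hP.exists_perfect_subset_forall_exists_strictAnti hPne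
  obtain ⟨Q', hQ'Q, hQ', hQ'ne, hQv⟩ := hQ.exists_perfect_subset_forall_exists_strictAnti hQne
  refine ⟨P', Q', hP', hP'ne, hQ', hQ'ne, fun z hz => ?_⟩
  obtain ⟨u, hu, huP, hux⟩ := hPu z.1 hz.1
  obtain ⟨v, hv, hvQ, hvy⟩ := hQv z.2 hz.2
  have hzK : z ∈ K := hPQ ⟨hP'P hz.1, hQ'Q hz.2⟩
  exact ⟨feeblyContinuousAt_of_continuousOn hf hzK hu hux hv hvy
    (fun n => hPQ ⟨huP n, hQ'Q hz.2⟩) fun n m => hPQ ⟨huP n, hvQ m⟩, hzK⟩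

theorem MeasureTheory.NullMeasurable.containsPerfectProduct_FC_inter {f : ℝ × ℝ → ℝ}
    (hf : NullMeasurable f volume) {B : Set (ℝ × ℝ)} (hB : NullMeasurableSet B volume)
    (hpos : 0 < volume B) : ContainsPerfectProduct (FC f ∩ B) := by
  obtain ⟨E, hEB, hE, hEae⟩ := hB.exists_measurable_subset_ae_eq
  rw [← measure_congr hEae] at hpos
  obtain ⟨K₀, hK₀E, hK₀, hK₀pos⟩ := hE.exists_lt_isCompact hpos
  obtain ⟨K, hKK₀, hK, hKpos, hfK⟩ := hf.exists_isCompact_continuousOn hK₀ hK₀pos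
  obtain ⟨P, Q, hP, hPne, hQ, hQne, h⟩ :=
    hfK.containsPerfectProduct_FC_inter (hK.containsPerfectProduct_of_volume_pos hKpos)
  exact ⟨P, Q, hP, hPne, hQ, hQne,
    h.trans (inter_subset_inter_right _ (hKK₀.trans (hK₀E.trans hEB)))⟩

/-- If a measurable hull of `A ∩ E` missed a non-null part of `E`, then `A` would meet that part, at
a point of the hull. -/
theorem hasFullOuterMeasure_of_forall_inter_nonempty {A : Set (ℝ × ℝ)}
    (hA : ∀ B : Set (ℝ × ℝ), NullMeasurableSet B volume → 0 < volume B → (A ∩ B).Nonempty) :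
    HasFullOuterMeasure A := by
  intro E hE
  refine le_antisymm (measure_mono inter_subset_right) ?_
  have hH : MeasurableSet (toMeasurable volume (A ∩ E)) := measurableSet_toMeasurable _ _
  have h0 : volume (E \ toMeasurable volume (A ∩ E)) = 0 := by
    by_contra h
    obtain ⟨z, hzA, hzE, hzH⟩ := hA _ (hE.diff hH.nullMeasurableSet) (pos_iff_ne_zero.2 h)
    exact hzH (subset_toMeasurable _ _ ⟨hzA, hzE⟩)
  rw [← measure_toMeasurable (A ∩ E)]
  exact measure_mono_ae (ae_le_set.2 h0)

theorem theorem2p3 (f : ℝ × ℝ → ℝ) :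
    (HasBaireProperty f →
      (∀ B : Set (ℝ × ℝ), BaireMeasurableSet B → ¬ IsMeagre B →
        ContainsPerfectProduct (FC f ∩ B)) ∧
      FC f ∈ residual (ℝ × ℝ)) ∧
    (NullMeasurable f volume →
      (∀ B : Set (ℝ × ℝ), NullMeasurableSet B volume → 0 < volume B →
        ContainsPerfectProduct (FC f ∩ B)) ∧
      HasFullOuterMeasure (FC f)) := by
  refine ⟨fun hf => ⟨fun B hB hBm => hB.containsPerfectProduct_inter hBm hf.mem_residual_FC,
    hf.mem_residual_FC⟩, fun hf => ⟨fun B hB hpos => hf.containsPerfectProduct_FC_inter hB hpos,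
    hasFullOuterMeasure_of_forall_inter_nonempty fun B hB hpos => ?_⟩⟩
  obtain ⟨P, Q, -, hP, -, hQ, h⟩ := hf.containsPerfectProduct_FC_inter hB hpos
  exact (hP.prod hQ).mono h
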